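/- Let $n\ge 2$ be a natural number and let $\sum_{m=1}^\infty a_m$ be a conditionally convergent series of real numbers, i.e. a series that converges but does not converge absolutely. For each permutation $\sigma\in\mathrm{Sym}(n)$ of $\{1,\dots,n\}$, let $(s_k^{(\sigma)})_{k\ge 1}$ be an arbitrary sequence of real numbers. Then there exist a bijection $\tau:\mathbb N^n\to\mathbb N$, where $\mathbb N=\{1,2,3,\dots\}$, and the corresponding rearrangement $b(j_1,\dots,j_n):=a_{\tau(j_1,\dots,j_n)}$ of $(a_m)_m$, such that for every $\sigma\in\mathrm{Sym}(n)$ and every $k\ge 1$ $$\sum_{j_1=1}^{k}\sum_{j_2=1}^{\infty}\dots\sum_{j_n=1}^{\infty} b(j_{\sigma(1)},\dots,j_{\sigma(n)})=s_k^{(\sigma)}.$$ Here each infinite sum is the limit of its partial sums in the natural order of its index, and the equation includes the assertion that all the iterated inner series, for all values of the outer indices over which one sums, converge to real numbers. -/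

import Mathlib

open Filter Topology

/-- The series `∑ a m` of real numbers is conditionally convergent: its partial sums converge to a
real number, but it does not converge absolutely. -/
def CondConvergent (a : ℕ → ℝ) : Prop :=
  (∃ S : ℝ, Tendsto (fun N => ∑ m ∈ Finset.range N, a m) atTop (𝓝 S)) ∧
    ¬ Summable (fun m => |a m|)

/-- The family `b`, indexed by `ι`, is a rearrangement of the sequence `a`: it is `a ∘ τ` for a
bijection `τ : ι → ℕ`. -/
def IsRearrangement {ι X : Type*} (a : ℕ → X) (b : ι → X) : Prop :=
  ∃ τ : ι ≃ ℕ, ∀ j, b j = a (τ j)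

/-- `HasIteratedSum n f s`: the iterated series `∑_{j₁} ∑_{j₂} ⋯ ∑_{jₙ} f (j₁, …, jₙ)`, each sum
over all of `ℕ` and `j₁` being outermost, converges to the real number `s`. Each single series is
the limit of its partial sums in the natural order, and every inner iterated series (for any fixed
values of the outer indices) is required to converge to a real number. -/
def HasIteratedSum : (n : ℕ) → ((Fin n → ℕ) → ℝ) → ℝ → Prop
  | 0, f, s => f Fin.elim0 = s
  | n + 1, f, s => ∃ g : ℕ → ℝ,
      (∀ j, HasIteratedSum n (fun v => f (Fin.cons j v)) (g j)) ∧
        Tendsto (fun N => ∑ j ∈ Finset.range N, g j) atTop (𝓝 s)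

/-- `HasPartialIteratedSum k n f s`: the partial sum `∑_{j₁} ∑_{j₂} ⋯ ∑_{jₙ} f (j₁, …, jₙ)`, in
which `j₁` runs over the first `k` natural numbers and `j₂, …, jₙ` over all of `ℕ`, exists and is
equal to `s`. (Indices start at `0`. For `n = 0` there is nothing to truncate.) -/
def HasPartialIteratedSum (k : ℕ) : (n : ℕ) → ((Fin n → ℕ) → ℝ) → ℝ → Prop
  | 0, f, s => f Fin.elim0 = s
  | n + 1, f, s => ∃ g : ℕ → ℝ,
      (∀ j < k, HasIteratedSum n (fun v => f (Fin.cons j v)) (g j)) ∧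
        ∑ j ∈ Finset.range k, g j = s

/-! The proof makes the sum along every axis-parallel line of `ℕ ^ (m + 1)` arbitrary
(`exists_rearrangement_line_sums`). Let the tail of a line in direction `p` consist of its points
whose `p`-th coordinate exceeds all the others. Tails of different lines are disjoint; the points in
no tail are those whose largest coordinate is attained twice. Split the series into countably many
subseries, one per tail and one for the tied points, each with divergent positive and negative
parts. By Riemann's theorem the subseries on a tail can be given any sum, in particular the wanted
line sum minus the finite head. A head meets only tails of lines with smaller `maxCoord`, and tied
points, so the targets are determined recursively.

For iterated sums, let `p` be the position filled by the innermost index. The line sums in direction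
`p` form an `m`-dimensional array, chosen freely for each `p`; induction on the dimension gives it
the required iterated sums. These arrays need not be rearrangements, so the induction can start in
dimension one with differences of the prescribed values. -/

/-! ### Riemann's theorem for a subseries -/

/-- Riemann's greedy merging: a divergent series of nonnegative terms and a divergent series of
nonpositive terms, both with terms tending to `0`, can be merged into a series with sum `T`. -/
theorem exists_merge_tendsto {p q : ℕ → ℝ} (hp : ∀ i, 0 ≤ p i) (hq : ∀ i, q i ≤ 0)
    (hp0 : Tendsto p atTop (𝓝 0)) (hq0 : Tendsto q atTop (𝓝 0))
    (hpS : Tendsto (fun N => ∑ i ∈ Finset.range N, p i) atTop atTop)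
    (hqS : Tendsto (fun N => ∑ i ∈ Finset.range N, q i) atTop atBot) (T : ℝ) :
    ∃ e : ℕ → ℕ ⊕ ℕ, Function.Bijective e ∧
      Tendsto (fun N => ∑ k ∈ Finset.range N, Sum.elim p q (e k)) atTop (𝓝 T) := by
  classical
  set P : ℕ → ℝ := fun N => ∑ i ∈ Finset.range N, p i with hP
  set Q : ℕ → ℝ := fun N => ∑ i ∈ Finset.range N, q i with hQ
  -- The state counts the terms of `p` and of `q` used so far; a term of `p` is taken exactly when
  -- the current sum is at most `T`.
  let step : ℕ × ℕ → ℕ × ℕ := fun x => if P x.1 + Q x.2 ≤ T then (x.1 + 1, x.2) else (x.1, x.2 + 1)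
  let st : ℕ → ℕ × ℕ := fun k => step^[k] (0, 0)
  let S : ℕ → ℝ := fun k => P (st k).1 + Q (st k).2
  have st_succ : ∀ k, st (k + 1) = step (st k) := fun k => Function.iterate_succ_apply' _ _ _
  have st_le : ∀ k, S k ≤ T → st (k + 1) = ((st k).1 + 1, (st k).2) := fun k h => by
    rw [st_succ]; exact if_pos h
  have st_gt : ∀ k, ¬ S k ≤ T → st (k + 1) = ((st k).1, (st k).2 + 1) := fun k h => by
    rw [st_succ]; exact if_neg h
  have S_le : ∀ k, S k ≤ T → S (k + 1) = S k + p (st k).1 := fun k h => by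
    simp only [S, st_le k h, hP, Finset.sum_range_succ]; ring
  have S_gt : ∀ k, ¬ S k ≤ T → S (k + 1) = S k + q (st k).2 := fun k h => by
    simp only [S, st_gt k h, hQ, Finset.sum_range_succ]; ring
  have mono1 : Monotone fun k => (st k).1 := monotone_nat_of_le_succ fun k => by
    by_cases h : S k ≤ T
    · simp [st_le k h]
    · simp [st_gt k h]
  have mono2 : Monotone fun k => (st k).2 := monotone_nat_of_le_succ fun k => by
    by_cases h : S k ≤ T
    · simp [st_le k h]
    · simp [st_gt k h]
  have freq_le : ∀ M, ∃ k, M ≤ k ∧ S k ≤ T := by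
    intro M
    by_contra! hcon
    have h : ∀ r, st (M + r) = ((st M).1, (st M).2 + r) := by
      intro r
      induction r with
      | zero => rfl
      | succ r ih =>
        have := st_gt (M + r) (not_le.2 (hcon _ (by omega)))
        rw [← add_assoc, this, ih, add_assoc]
    have h2 : Tendsto (fun r => Q ((st M).2 + r)) atTop atBot :=
      hqS.comp (tendsto_atTop_mono (fun r => Nat.le_add_left r _) tendsto_id)
    obtain ⟨r, hr⟩ := (h2.eventually (eventually_le_atBot (T - P (st M).1))).exists
    have := hcon (M + r) (by omega)
    simp only [S, h] at this
    linarith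
  have freq_gt : ∀ M, ∃ k, M ≤ k ∧ T < S k := by
    intro M
    by_contra! hcon
    have h : ∀ r, st (M + r) = ((st M).1 + r, (st M).2) := by
      intro r
      induction r with
      | zero => rfl
      | succ r ih =>
        have := st_le (M + r) (hcon _ (by omega))
        rw [← add_assoc, this, ih, add_assoc]
    have h2 : Tendsto (fun r => P ((st M).1 + r)) atTop atTop :=
      hpS.comp (tendsto_atTop_mono (fun r => Nat.le_add_left r _) tendsto_id)
    obtain ⟨r, hr⟩ := (h2.eventually (eventually_gt_atTop (T - Q (st M).2))).exists
    have := hcon (M + r) (by omega)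
    simp only [S, h] at this
    linarith
  have hit1 : ∀ i, ∃ k, S k ≤ T ∧ (st k).1 = i := by
    intro i
    induction i with
    | zero =>
      obtain ⟨k, -, hk⟩ := freq_le 0
      have hex : ∃ k, S k ≤ T := ⟨k, hk⟩
      refine ⟨Nat.find hex, Nat.find_spec hex, ?_⟩
      have : ∀ r ≤ Nat.find hex, (st r).1 = 0 := by
        intro r
        induction r with
        | zero => intro _; rfl
        | succ r ih =>
          intro hr
          rw [st_gt r (Nat.find_min hex (by omega))]
          exact ih (by omega)
      exact this _ le_rfl
    | succ i ih =>
      obtain ⟨k0, hk0, hi⟩ := ih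
      obtain ⟨k, hk, hk'⟩ := freq_le (k0 + 1)
      have hex : ∃ r, S (k0 + 1 + r) ≤ T := ⟨k - (k0 + 1), by rwa [Nat.add_sub_cancel' hk]⟩
      refine ⟨k0 + 1 + Nat.find hex, Nat.find_spec hex, ?_⟩
      -- Until the sum next returns to at most `T`, only terms of `q` are taken, so the first
      -- counter is frozen.
      have : ∀ r ≤ Nat.find hex, (st (k0 + 1 + r)).1 = i + 1 := by
        intro r
        induction r with
        | zero => intro _; rw [add_zero, st_le k0 hk0, hi]
        | succ r ih =>
          intro hr
          rw [← add_assoc, st_gt _ (Nat.find_min hex (by omega))]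
          exact ih (by omega)
      exact this _ le_rfl
  have hit2 : ∀ i, ∃ k, ¬ S k ≤ T ∧ (st k).2 = i := by
    intro i
    induction i with
    | zero =>
      obtain ⟨k, -, hk⟩ := freq_gt 0
      have hex : ∃ k, ¬ S k ≤ T := ⟨k, not_le.2 hk⟩
      refine ⟨Nat.find hex, Nat.find_spec hex, ?_⟩
      have : ∀ r ≤ Nat.find hex, (st r).2 = 0 := by
        intro r
        induction r with
        | zero => intro _; rfl
        | succ r ih =>
          intro hr
          rw [st_le r (not_not.1 (Nat.find_min hex (by omega)))]
          exact ih (by omega)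
      exact this _ le_rfl
    | succ i ih =>
      obtain ⟨k0, hk0, hi⟩ := ih
      obtain ⟨k, hk, hk'⟩ := freq_gt (k0 + 1)
      have hex : ∃ r, ¬ S (k0 + 1 + r) ≤ T :=
        ⟨k - (k0 + 1), by rw [Nat.add_sub_cancel' hk]; exact not_le.2 hk'⟩
      refine ⟨k0 + 1 + Nat.find hex, Nat.find_spec hex, ?_⟩
      have : ∀ r ≤ Nat.find hex, (st (k0 + 1 + r)).2 = i + 1 := by
        intro r
        induction r with
        | zero => intro _; rw [add_zero, st_gt k0 hk0, hi]
        | succ r ih =>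
          intro hr
          rw [← add_assoc, st_le _ (not_not.1 (Nat.find_min hex (by omega)))]
          exact ih (by omega)
      exact this _ le_rfl
  let e : ℕ → ℕ ⊕ ℕ := fun k => if S k ≤ T then Sum.inl (st k).1 else Sum.inr (st k).2
  have e_ne : ∀ k l, k < l → e k ≠ e l := by
    intro k l hkl
    by_cases hk : S k ≤ T <;> by_cases hl : S l ≤ T <;> simp only [e, hk, hl, if_true, if_false]
    · have := mono1 (Nat.succ_le_of_lt hkl)
      simp only [Nat.succ_eq_add_one, st_le k hk] at this
      simp only [ne_eq, Sum.inl.injEq]; omega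
    · simp
    · simp
    · have := mono2 (Nat.succ_le_of_lt hkl)
      simp only [Nat.succ_eq_add_one, st_gt k hk] at this
      simp only [ne_eq, Sum.inr.injEq]; omega
  have sum_eq : ∀ N, ∑ k ∈ Finset.range N, Sum.elim p q (e k) = S N := by
    intro N
    induction N with
    | zero => simp [S, st, hP, hQ]
    | succ N ih =>
      rw [Finset.sum_range_succ, ih]
      by_cases h : S N ≤ T
      · rw [S_le N h]; simp [e, h]
      · rw [S_gt N h]; simp [e, h]
  refine ⟨e, ⟨fun k l h => ?_, ?_⟩, ?_⟩
  · rcases lt_trichotomy k l with hkl | hkl | hkl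
    · exact absurd h (e_ne k l hkl)
    · exact hkl
    · exact absurd h.symm (e_ne l k hkl)
  · rintro (i | i)
    · obtain ⟨k, hk, rfl⟩ := hit1 i
      exact ⟨k, if_pos hk⟩
    · obtain ⟨k, hk, rfl⟩ := hit2 i
      exact ⟨k, if_neg hk⟩
  · simp only [sum_eq]
    have t1 : Tendsto (fun k => (st k).1) atTop atTop :=
      tendsto_atTop_atTop_of_monotone mono1 fun i => (hit1 i).imp fun k hk => hk.2.ge
    have t2 : Tendsto (fun k => (st k).2) atTop atTop :=
      tendsto_atTop_atTop_of_monotone mono2 fun i => (hit2 i).imp fun k hk => hk.2.ge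
    rw [tendsto_order]
    constructor
    · intro x hx
      obtain ⟨M, hM⟩ := eventually_atTop.1
        ((hq0.comp t2).eventually (lt_mem_nhds (show x - T < 0 by linarith)))
      -- From a time when the sum is above `T`, every downward step starts above `T` and is shorter
      -- than `T - x`, so the sum stays above `x`.
      obtain ⟨k0, hk0, hk0'⟩ := freq_gt M
      refine eventually_atTop.2 ⟨k0, fun k hk => ?_⟩
      induction k, hk using Nat.le_induction with
      | base => linarith
      | succ k hk ih =>
        by_cases h : S k ≤ T
        · rw [S_le k h]; linarith [hp (st k).1]
        · rw [S_gt k h]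
          have := hM k (by omega)
          simp only [Function.comp] at this
          linarith
    · intro x hx
      obtain ⟨M, hM⟩ := eventually_atTop.1
        ((hp0.comp t1).eventually (gt_mem_nhds (show 0 < x - T by linarith)))
      obtain ⟨k0, hk0, hk0'⟩ := freq_le M
      refine eventually_atTop.2 ⟨k0, fun k hk => ?_⟩
      induction k, hk using Nat.le_induction with
      | base => linarith
      | succ k hk ih =>
        by_cases h : S k ≤ T
        · rw [S_le k h]
          have := hM k (by omega)
          simp only [Function.comp] at this
          linarith
        · rw [S_gt k h]; linarith [hq (st k).2]

/-- Riemann's rearrangement theorem for the subseries with index set `A`. -/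
theorem exists_enumeration_tendsto {a : ℕ → ℝ} (ha : Tendsto a atTop (𝓝 0)) {A : Set ℕ}
    (hpos : ¬ Summable (A.indicator fun m => max (a m) 0))
    (hneg : ¬ Summable (A.indicator fun m => max (-a m) 0)) (T : ℝ) :
    ∃ E : ℕ → ℕ, Function.Injective E ∧ Set.range E = A ∧
      Tendsto (fun N => ∑ k ∈ Finset.range N, a (E k)) atTop (𝓝 T) := by
  classical
  -- Zero terms are put with the negative ones, so that `P` and `Q` partition `A`.
  let P : Set ℕ := {m | m ∈ A ∧ 0 < a m}
  let Q : Set ℕ := {m | m ∈ A ∧ a m ≤ 0}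
  have hP : ¬ Summable fun m : P => a m := by
    intro h
    refine hpos ?_
    have := summable_subtype_iff_indicator.1 (show Summable (a ∘ ((↑) : P → ℕ)) from h)
    refine this.congr fun m => ?_
    by_cases hA : m ∈ A <;> by_cases h0 : 0 < a m <;> simp [Set.indicator, P, hA, h0, le_of_lt]
    exact not_lt.1 h0
  have hQ : ¬ Summable fun m : Q => -a m := by
    intro h
    refine hneg ?_
    have := summable_subtype_iff_indicator.1
      (show Summable ((fun m => -a m) ∘ ((↑) : Q → ℕ)) from h)
    refine this.congr fun m => ?_
    by_cases hA : m ∈ A <;> by_cases h0 : a m ≤ 0 <;> simp [Set.indicator, Q, hA, h0]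
    exact (not_le.1 h0).le
  have iP : Infinite P := by
    by_contra h
    rw [not_infinite_iff_finite] at h
    exact hP Summable.of_finite
  have iQ : Infinite Q := by
    by_contra h
    rw [not_infinite_iff_finite] at h
    exact hQ Summable.of_finite
  obtain ⟨eP⟩ : Nonempty (ℕ ≃ P) := nonempty_equiv_of_countable
  obtain ⟨eQ⟩ : Nonempty (ℕ ≃ Q) := nonempty_equiv_of_countable
  have tP : Tendsto (fun i => a (eP i)) atTop (𝓝 0) :=
    ha.comp (Subtype.val_injective.comp eP.injective).nat_tendsto_atTop
  have tQ : Tendsto (fun i => a (eQ i)) atTop (𝓝 0) :=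
    ha.comp (Subtype.val_injective.comp eQ.injective).nat_tendsto_atTop
  have sP : Tendsto (fun N => ∑ i ∈ Finset.range N, a (eP i)) atTop atTop :=
    (not_summable_iff_tendsto_nat_atTop_of_nonneg fun i => (eP i).2.2.le).1
      fun h => hP (eP.summable_iff.1 h)
  have sQ : Tendsto (fun N => ∑ i ∈ Finset.range N, -a (eQ i)) atTop atTop :=
    (not_summable_iff_tendsto_nat_atTop_of_nonneg fun i => neg_nonneg.2 (eQ i).2.2).1
      fun h => hQ (eQ.summable_iff.1 h)
  simp only [Finset.sum_neg_distrib, tendsto_neg_atTop_iff] at sQ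
  obtain ⟨e, he, hT⟩ := exists_merge_tendsto (fun i => (eP i).2.2.le) (fun i => (eQ i).2.2)
    tP tQ sP sQ T
  let F : ℕ ⊕ ℕ → ℕ := Sum.elim (fun i => eP i) (fun i => eQ i)
  have hF : Function.Injective F := by
    refine (Subtype.val_injective.comp eP.injective).sumElim
      (Subtype.val_injective.comp eQ.injective) fun i j h => ?_
    have h1 := (eP i).2.2
    have h2 := (eQ j).2.2
    simp only [Function.comp] at h
    rw [h] at h1
    linarith
  refine ⟨F ∘ e, hF.comp he.1, ?_, ?_⟩
  · rw [he.2.range_comp, Set.Sum.elim_range]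
    ext m
    constructor
    · rintro (⟨i, rfl⟩ | ⟨i, rfl⟩)
      · exact (eP i).2.1
      · exact (eQ i).2.1
    · intro hm
      rcases lt_or_ge 0 (a m) with h | h
      · exact Or.inl ⟨eP.symm ⟨m, hm, h⟩, by simp⟩
      · exact Or.inr ⟨eQ.symm ⟨m, hm, h⟩, by simp⟩
  · refine hT.congr fun N => Finset.sum_congr rfl fun k _ => ?_
    simp only [F, Function.comp]
    cases e k <;> rfl

/-! ### Splitting a conditionally convergent series -/

theorem CondConvergent.tendsto_zero {a : ℕ → ℝ} (ha : CondConvergent a) :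
    Tendsto a atTop (𝓝 0) := by
  obtain ⟨⟨S, hS⟩, -⟩ := ha
  have := ((tendsto_add_atTop_iff_nat 1).2 hS).sub hS
  simpa [Finset.sum_range_succ] using this

/-- If the positive parts were summable, subtracting the convergent series would make the negative
parts summable, hence also the absolute values. -/
theorem not_summable_max_zero {a : ℕ → ℝ}
    (hS : ∃ S, Tendsto (fun N => ∑ m ∈ Finset.range N, a m) atTop (𝓝 S))
    (ha : ¬ Summable fun m => |a m|) : ¬ Summable fun m => max (a m) 0 := by
  intro h
  obtain ⟨S, hS⟩ := hS
  have h1 := h.hasSum.tendsto_sum_nat.sub hS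
  simp only [← Finset.sum_sub_distrib] at h1
  have h2 : Summable fun m => max (a m) 0 - a m := by
    rw [summable_iff_not_tendsto_nat_atTop_of_nonneg fun m => sub_nonneg.2 (le_max_left _ _)]
    exact fun h => not_tendsto_nhds_of_tendsto_atTop h _ h1
  refine ha ((h.add h2).congr fun m => ?_)
  rcases le_total 0 (a m) with h | h
  · simp [abs_of_nonneg h, max_eq_left h]
  · simp [abs_of_nonpos h, max_eq_right h]

theorem CondConvergent.not_summable_pos {a : ℕ → ℝ} (ha : CondConvergent a) :
    ¬ Summable fun m => max (a m) 0 := not_summable_max_zero ha.1 ha.2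

theorem CondConvergent.not_summable_neg {a : ℕ → ℝ} (ha : CondConvergent a) :
    ¬ Summable fun m => max (-a m) 0 := by
  obtain ⟨⟨S, hS⟩, h⟩ := ha
  exact not_summable_max_zero ⟨-S, by simpa using hS.neg⟩ (by simpa using h)

/-- Two divergent series of nonnegative terms can be split simultaneously into countably many
divergent subseries. -/
theorem exists_coloring_not_summable {f g : ℕ → ℝ} (hf : ∀ m, 0 ≤ f m) (hg : ∀ m, 0 ≤ g m)
    (hfS : ¬ Summable f) (hgS : ¬ Summable g) (C : Type*) [Countable C] [Nonempty C] :
    ∃ χ : ℕ → C, ∀ c, ¬ Summable ((χ ⁻¹' {c}).indicator f) ∧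
      ¬ Summable ((χ ⁻¹' {c}).indicator g) := by
  classical
  rw [not_summable_iff_tendsto_nat_atTop_of_nonneg hf] at hfS
  rw [not_summable_iff_tendsto_nat_atTop_of_nonneg hg] at hgS
  -- Cut `ℕ` into blocks on which `f` and `g` both sum to at least `1`; a colour given to infinitely
  -- many blocks then violates the Cauchy criterion for both.
  have hnext : ∀ N, ∃ M, N < M ∧ 1 ≤ ∑ m ∈ Finset.Ico N M, f m ∧
      1 ≤ ∑ m ∈ Finset.Ico N M, g m := by
    intro N
    obtain ⟨M, h1, h2, h3⟩ := ((eventually_gt_atTop N).and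
      ((hfS.eventually_ge_atTop (∑ m ∈ Finset.range N, f m + 1)).and
        (hgS.eventually_ge_atTop (∑ m ∈ Finset.range N, g m + 1)))).exists
    refine ⟨M, h1, ?_, ?_⟩
    · rw [Finset.sum_Ico_eq_sub _ h1.le]; linarith
    · rw [Finset.sum_Ico_eq_sub _ h1.le]; linarith
  choose next hlt hsf hsg using hnext
  let t : ℕ → ℕ := fun k => next^[k] 0
  have t_succ : ∀ k, t (k + 1) = next (t k) := fun k => Function.iterate_succ_apply' _ _ _
  have t_mono : StrictMono t := strictMono_nat_of_lt_succ fun k => by rw [t_succ]; exact hlt _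
  let blk : ℕ → ℕ := fun m => Nat.findGreatest (fun k => t k ≤ m) m
  have hblk : ∀ k m, m ∈ Finset.Ico (t k) (t (k + 1)) → blk m = k := by
    intro k m hm
    rw [Finset.mem_Ico] at hm
    refine Nat.findGreatest_eq_iff.2 ⟨(t_mono.id_le k).trans hm.1, fun _ => hm.1, ?_⟩
    intro r hr _ h
    exact absurd (t_mono.monotone (Nat.succ_le_of_lt hr)) (by simp only [Nat.succ_eq_add_one]; omega)
  -- The factor `ℕ` makes every colour occur on infinitely many blocks.
  obtain ⟨φ⟩ : Nonempty (ℕ ≃ C × ℕ) := nonempty_equiv_of_countable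
  have key : ∀ h : ℕ → ℝ, (∀ N, 1 ≤ ∑ m ∈ Finset.Ico N (next N), h m) → ∀ c,
      ¬ Summable (((fun m => (φ (blk m)).1) ⁻¹' {c}).indicator h) := by
    intro h h1 c hsum
    obtain ⟨s, hs⟩ := summable_iff_vanishing_norm.1 hsum 1 one_pos
    have hinj : Function.Injective fun r => φ.symm (c, r) := fun r r' hr => by simpa using hr
    obtain ⟨r, hr⟩ := (hinj.nat_tendsto_atTop.eventually_gt_atTop (s.sup id)).exists
    set k := φ.symm (c, r) with hk
    have hd : Disjoint (Finset.Ico (t k) (t (k + 1))) s := by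
      rw [Finset.disjoint_left]
      intro m hm hms
      have h2 : m ≤ s.sup id := Finset.le_sup (f := id) hms
      have h3 := t_mono.id_le k
      rw [Finset.mem_Ico] at hm
      simp only [id] at h3
      omega
    have h2 := hs _ hd
    rw [Finset.sum_congr rfl (g := h) fun m hm => by
      rw [Set.indicator_of_mem]
      simp [hblk k m hm, hk]] at h2
    have h3 := h1 (t k)
    rw [← t_succ] at h3
    exact absurd (h3.trans (Real.le_norm_self _)) (not_le.2 h2)
  exact ⟨fun m => (φ (blk m)).1, fun c => ⟨key f hsf c, key g hsg c⟩⟩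

/-- A system of equations `T x = F x T` is solvable if `F x` looks only at values of `T` at points
of smaller rank. -/
theorem exists_forall_eq_of_rank {α β : Type*} [Nonempty β] (μ : α → ℕ) (F : α → (α → β) → β)
    (hF : ∀ x T T', (∀ y, μ y < μ x → T y = T' y) → F x T = F x T') :
    ∃ T : α → β, ∀ x, T x = F x T := by
  -- Iterating from an arbitrary start, the value at `x` is stable from step `μ x + 1` on.
  let U : ℕ → α → β := fun k => (fun T x => F x T)^[k] fun _ => Classical.arbitrary β
  have U_succ : ∀ k x, U (k + 1) x = F x (U k) := fun k x =>
    congrFun (Function.iterate_succ_apply' _ _ _) x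
  have hU : ∀ k l x, μ x < k → μ x < l → U k x = U l x := by
    intro k
    induction k with
    | zero => intro l x h; omega
    | succ k ih =>
      rintro (_ | l) x hk hl
      · omega
      · rw [U_succ, U_succ]
        exact hF _ _ _ fun y hy => ih l y (by omega) (by omega)
  refine ⟨fun x => U (μ x + 1) x, fun x => ?_⟩
  exact (U_succ _ _).trans (hF _ _ _ fun y hy => hU _ _ _ hy (by omega))

/-! ### Tails of lines -/

/-- The largest coordinate of `w`. -/
def maxCoord {m : ℕ} (w : Fin m → ℕ) : ℕ := Finset.univ.sup w

theorem le_maxCoord {m : ℕ} (w : Fin m → ℕ) (i : Fin m) : w i ≤ maxCoord w :=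
  Finset.le_sup (f := w) (Finset.mem_univ i)

/-- The points all of whose coordinates are dominated by some other coordinate. -/
def tiedPoints (n : ℕ) : Set (Fin n → ℕ) := {v | ∀ p, ∃ q, q ≠ p ∧ v p ≤ v q}

theorem infinite_tiedPoints {m : ℕ} (hm : 1 ≤ m) : (tiedPoints (m + 1)).Infinite := by
  have : Nontrivial (Fin (m + 1)) := Fin.nontrivial_iff_two_le.2 (by omega)
  refine Set.infinite_of_injective_forall_mem (f := fun (k : ℕ) (_ : Fin (m + 1)) => k)
    (fun k l h => congrFun h 0) fun k p => ?_
  obtain ⟨q, hq⟩ := exists_ne p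
  exact ⟨q, hq, le_rfl⟩

/-- The points `(c, k)` with `c = some (p, w)` enumerate the part of the line in direction `p`
through `w` lying beyond the largest coordinate of `w`; those with `c = none` enumerate the range
of `fr`. -/
def tailPoint {m : ℕ} (fr : ℕ → Fin (m + 1) → ℕ) :
    Option (Fin (m + 1) × (Fin m → ℕ)) × ℕ → Fin (m + 1) → ℕ
  | (none, k) => fr k
  | (some (p, w), k) => p.insertNth (α := fun _ => ℕ) (maxCoord w + 1 + k) w

theorem insertNth_lt_of_maxCoord_lt {m : ℕ} {p : Fin (m + 1)} {w : Fin m → ℕ} {t : ℕ}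
    (h : maxCoord w < t) {q : Fin (m + 1)} (hq : q ≠ p) :
    p.insertNth (α := fun _ => ℕ) t w q < t := by
  obtain ⟨i, rfl⟩ := Fin.exists_succAbove_eq hq
  rw [Fin.insertNth_apply_succAbove]
  exact (le_maxCoord w i).trans_lt h

theorem tailPoint_some_notMem {m : ℕ} (fr : ℕ → Fin (m + 1) → ℕ) (l : Fin (m + 1) × (Fin m → ℕ))
    (k : ℕ) : tailPoint fr (some l, k) ∉ tiedPoints (m + 1) := by
  obtain ⟨p, w⟩ := l
  intro h
  obtain ⟨q, hq, hle⟩ := h p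
  have := insertNth_lt_of_maxCoord_lt (w := w) (t := maxCoord w + 1 + k) (by omega) hq
  simp only [tailPoint, Fin.insertNth_apply_same] at hle
  omega

/-- A point that is not tied has a unique strictly largest coordinate; its position is the direction
of the line, and the remaining coordinates are `w`. -/
theorem bijective_tailPoint {m : ℕ} (hm : 1 ≤ m) {fr : ℕ → Fin (m + 1) → ℕ} (hfr : Function.Injective fr)
    (hran : Set.range fr = tiedPoints (m + 1)) : Function.Bijective (tailPoint fr) := by
  have hmem : ∀ k, fr k ∈ tiedPoints (m + 1) := fun k => hran ▸ Set.mem_range_self k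
  constructor
  · rintro ⟨_ | ⟨p, w⟩, k⟩ ⟨_ | ⟨q, u⟩, l⟩ h
    · rw [hfr h]
    · exact absurd (h ▸ hmem k : tailPoint fr (some (q, u), l) ∈ _) (tailPoint_some_notMem _ _ _)
    · exact absurd (h.symm ▸ hmem l : tailPoint fr (some (p, w), k) ∈ _)
        (tailPoint_some_notMem _ _ _)
    · simp only [tailPoint] at h
      have hpq : p = q := by
        by_contra hne
        have h1 := insertNth_lt_of_maxCoord_lt (w := w) (t := maxCoord w + 1 + k) (by omega)
          (Ne.symm hne)
        have h2 := insertNth_lt_of_maxCoord_lt (w := u) (t := maxCoord u + 1 + l) (by omega) hne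
        rw [h, Fin.insertNth_apply_same] at h1
        rw [← h, Fin.insertNth_apply_same] at h2
        omega
      subst hpq
      obtain ⟨h1, rfl⟩ := (Fin.insertNth_injective2 (α := fun _ => ℕ)) h
      rw [show k = l by omega]
  · intro v
    by_cases hv : v ∈ tiedPoints (m + 1)
    · rw [← hran] at hv
      obtain ⟨k, rfl⟩ := hv
      exact ⟨(none, k), rfl⟩
    · simp only [tiedPoints, Set.mem_ofPred_eq, not_forall, not_exists, not_and, not_le] at hv
      obtain ⟨p, hp⟩ := hv
      have hpos : maxCoord (p.removeNth v) < v p := by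
        refine (Finset.sup_lt_iff ?_).2 fun i _ => hp _ (Fin.succAbove_ne p i)
        exact (Nat.zero_le _).trans_lt (hp _ (Fin.succAbove_ne p ⟨0, hm⟩))
      refine ⟨(some (p, p.removeNth v), v p - (maxCoord (p.removeNth v) + 1)), ?_⟩
      rw [tailPoint, Nat.add_sub_cancel' hpos, Fin.insertNth_self_removeNth]

/-! ### Prescribing all line sums -/

/-- Every line of `ℕ ^ (m + 1)` can be given a prescribed sum by a rearrangement of a conditionally
convergent series. -/
theorem exists_rearrangement_line_sums {m : ℕ} (hm : 1 ≤ m) {a : ℕ → ℝ} (ha : CondConvergent a)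
    (L : Fin (m + 1) → (Fin m → ℕ) → ℝ) :
    ∃ b : (Fin (m + 1) → ℕ) → ℝ, IsRearrangement a b ∧ ∀ p w,
      Tendsto (fun N => ∑ t ∈ Finset.range N, b (p.insertNth (α := fun _ => ℕ) t w)) atTop
        (𝓝 (L p w)) := by
  obtain ⟨χ, hχ⟩ := exists_coloring_not_summable (fun m => le_max_right (a m) 0)
    (fun m => le_max_right (-a m) 0) ha.not_summable_pos ha.not_summable_neg
    (Option (Fin (m + 1) × (Fin m → ℕ)))
  choose E hEinj hEran hE using fun c =>
    exists_enumeration_tendsto ha.tendsto_zero (hχ c).1 (hχ c).2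
  have := (infinite_tiedPoints hm).to_subtype
  obtain ⟨φ⟩ : Nonempty (ℕ ≃ tiedPoints (m + 1)) := nonempty_equiv_of_countable
  set fr : ℕ → Fin (m + 1) → ℕ := fun k => φ k with hfr
  have hran : Set.range fr = tiedPoints (m + 1) := by
    ext v
    exact ⟨fun ⟨k, hk⟩ => hk ▸ (φ k).2, fun hv => ⟨φ.symm ⟨v, hv⟩, by simp [hfr]⟩⟩
  let Ψ := Equiv.ofBijective _ (bijective_tailPoint hm (Subtype.val_injective.comp φ.injective) hran)
  -- The tied points receive a subseries with sum `0`; this value is arbitrary.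
  let tgt : (Fin (m + 1) × (Fin m → ℕ) → ℝ) → Option (Fin (m + 1) × (Fin m → ℕ)) → ℝ :=
    fun T c => c.elim 0 T
  let τ : (Fin (m + 1) × (Fin m → ℕ) → ℝ) → (Fin (m + 1) → ℕ) → ℕ :=
    fun T v => E (Ψ.symm v).1 (tgt T (Ψ.symm v).1) (Ψ.symm v).2
  -- The tail target is the line sum minus the head, while the head itself depends on the targets of
  -- other tails.
  obtain ⟨T, hT⟩ := exists_forall_eq_of_rank (fun l : Fin (m + 1) × (Fin m → ℕ) => maxCoord l.2)
    (fun l T => L l.1 l.2 - ∑ t ∈ Finset.range (maxCoord l.2 + 1),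
      a (τ T (l.1.insertNth (α := fun _ => ℕ) t l.2))) (by
    rintro ⟨p, w⟩ T T' h
    refine congrArg (L p w - ·) (Finset.sum_congr rfl fun t ht => congrArg a ?_)
    obtain ⟨⟨c, k⟩, hck⟩ := Ψ.surjective (p.insertNth (α := fun _ => ℕ) t w)
    simp only [τ, ← hck, Equiv.symm_apply_apply]
    rcases c with _ | ⟨q, u⟩
    · rfl
    -- All coordinates of a head point are at most `maxCoord w`, but a point on the tail through `u`
    -- has a coordinate exceeding `maxCoord u`.
    · have hlt : maxCoord u < maxCoord w := by
        have h1 : maxCoord u + 1 + k = p.insertNth (α := fun _ => ℕ) t w q := by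
          rw [← hck]
          exact (Fin.insertNth_apply_same (α := fun _ => ℕ) q (maxCoord u + 1 + k) u).symm
        have h2 : p.insertNth (α := fun _ => ℕ) t w q ≤ maxCoord w := by
          have ht : t < maxCoord w + 1 := Finset.mem_range.1 ht
          rcases Fin.eq_self_or_eq_succAbove p q with rfl | ⟨i, rfl⟩
          · rw [Fin.insertNth_apply_same]; omega
          · rw [Fin.insertNth_apply_succAbove]; exact le_maxCoord w i
        omega
      simp only [tgt, Option.elim, h (q, u) hlt])
  have hτ : Function.Bijective (τ T) := by
    -- The colour of an index reveals the tail it was placed on.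
    have hcol : ∀ c k, χ (E c (tgt T c) k) = c := fun c k => by
      have : E c (tgt T c) k ∈ χ ⁻¹' {c} := hEran c (tgt T c) ▸ Set.mem_range_self k
      simpa using this
    constructor
    · intro v v' h
      simp only [τ] at h
      have h1 : (Ψ.symm v).1 = (Ψ.symm v').1 := by
        have := congrArg χ h
        rwa [hcol, hcol] at this
      rw [h1] at h
      exact Ψ.symm.injective (Prod.ext h1 (hEinj _ _ h))
    · intro r
      have : r ∈ Set.range (E (χ r) (tgt T (χ r))) := by rw [hEran]; simp
      obtain ⟨k, hk⟩ := this
      exact ⟨Ψ (χ r, k), by simp only [τ, Equiv.symm_apply_apply, hk]⟩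
  refine ⟨fun v => a (τ T v), ⟨Equiv.ofBijective _ hτ, fun _ => rfl⟩, fun p w => ?_⟩
  rw [← tendsto_add_atTop_iff_nat (maxCoord w + 1)]
  have h1 := (hE (some (p, w)) (T (p, w))).const_add
    (∑ t ∈ Finset.range (maxCoord w + 1), a (τ T (p.insertNth (α := fun _ => ℕ) t w)))
  rw [show ∑ t ∈ Finset.range (maxCoord w + 1), a (τ T (p.insertNth (α := fun _ => ℕ) t w)) +
    T (p, w) = L p w by rw [hT (p, w)]; ring] at h1
  refine h1.congr fun N => ?_
  rw [add_comm N, Finset.sum_range_add _ (maxCoord w + 1) N]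
  refine congrArg _ (Finset.sum_congr rfl fun k _ => ?_)
  have : p.insertNth (α := fun _ => ℕ) (maxCoord w + 1 + k) w = Ψ (some (p, w), k) := rfl
  simp only [τ, this, Equiv.symm_apply_apply, tgt, Option.elim]

/-! ### From line sums to iterated sums -/

theorem hasIteratedSum_succ_of_innermost {n : ℕ} {f : (Fin (n + 1) → ℕ) → ℝ}
    {g : (Fin n → ℕ) → ℝ} {s : ℝ}
    (hfg : ∀ w, Tendsto (fun N => ∑ t ∈ Finset.range N, f (Fin.snoc (α := fun _ => ℕ) w t)) atTop
      (𝓝 (g w))) (hg : HasIteratedSum n g s) : HasIteratedSum (n + 1) f s := by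
  induction n generalizing s with
  | zero =>
    refine ⟨fun t => f (Fin.snoc (α := fun _ => ℕ) Fin.elim0 t), fun t => ?_, ?_⟩
    · exact congrArg f (by ext i; fin_cases i; rfl)
    · have h := hfg Fin.elim0
      rwa [show g Fin.elim0 = s from hg] at h
  | succ n ih =>
    obtain ⟨G, hG, hs⟩ := hg
    refine ⟨G, fun j => ih (fun w => ?_) (hG j), hs⟩
    simpa only [Fin.cons_snoc_eq_snoc_cons] using hfg (Fin.cons j w)

/-- The condition `1 ≤ n` keeps the truncated outermost index distinct from the innermost one. -/
theorem hasPartialIteratedSum_succ_of_innermost {k n : ℕ} (hn : 1 ≤ n)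
    {f : (Fin (n + 1) → ℕ) → ℝ} {g : (Fin n → ℕ) → ℝ} {s : ℝ}
    (hfg : ∀ w, Tendsto (fun N => ∑ t ∈ Finset.range N, f (Fin.snoc (α := fun _ => ℕ) w t)) atTop
      (𝓝 (g w))) (hg : HasPartialIteratedSum k n g s) : HasPartialIteratedSum k (n + 1) f s := by
  obtain ⟨n, rfl⟩ := Nat.exists_eq_add_of_le' hn
  obtain ⟨G, hG, hs⟩ := hg
  refine ⟨G, fun j hj => hasIteratedSum_succ_of_innermost (fun w => ?_) (hG j hj), hs⟩
  simpa only [Fin.cons_snoc_eq_snoc_cons] using hfg (Fin.cons j w)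

/-- A permutation of `Fin (m + 1)` restricts to a permutation of `Fin m` away from the preimage of
the last element. -/
theorem Equiv.Perm.exists_castSucc_eq_succAbove {m : ℕ} (σ : Equiv.Perm (Fin (m + 1))) :
    ∃ ρ : Equiv.Perm (Fin m), ∀ i, σ ((σ.symm (Fin.last m)).succAbove i) = (ρ i).castSucc := by
  have h : ∀ i, σ ((σ.symm (Fin.last m)).succAbove i) ≠ Fin.last m := fun i hi =>
    Fin.succAbove_ne _ i (σ.injective (by rw [hi, Equiv.apply_symm_apply]))
  have hinj : Function.Injective fun i => (σ ((σ.symm (Fin.last m)).succAbove i)).castPred (h i) :=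
    fun i j hij => Fin.succAbove_right_injective (σ.injective (Fin.castPred_inj.1 hij))
  exact ⟨Equiv.ofBijective _ (Finite.injective_iff_bijective.1 hinj), fun i => by simp⟩

/-- Arrays with prescribed partial iterated sums in dimension `m` provide the line sums for a
rearrangement with prescribed partial iterated sums in dimension `m + 1`. -/
theorem exists_rearrangement_succ {m : ℕ} (hm : 1 ≤ m) {a : ℕ → ℝ} (ha : CondConvergent a)
    (ih : ∀ s : Equiv.Perm (Fin m) → ℕ → ℝ, ∃ b : (Fin m → ℕ) → ℝ,
      ∀ (σ : Equiv.Perm (Fin m)) (k : ℕ), 1 ≤ k →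
        HasPartialIteratedSum k m (fun j => b (fun i => j (σ i))) (s σ k))
    (s : Equiv.Perm (Fin (m + 1)) → ℕ → ℝ) :
    ∃ b : (Fin (m + 1) → ℕ) → ℝ, IsRearrangement a b ∧
      ∀ (σ : Equiv.Perm (Fin (m + 1))) (k : ℕ), 1 ≤ k →
        HasPartialIteratedSum k (m + 1) (fun j => b (fun i => j (σ i))) (s σ k) := by
  choose ρ hρ using Equiv.Perm.exists_castSucc_eq_succAbove (m := m)
  let D : Equiv.Perm (Fin (m + 1)) → Fin (m + 1) × Equiv.Perm (Fin m) :=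
    fun σ => (σ.symm (Fin.last m), ρ σ)
  have hD : Function.Injective D := by
    intro σ σ' h
    obtain ⟨h1, h2⟩ := Prod.mk.inj h
    ext1 i
    rcases Fin.eq_self_or_eq_succAbove (σ.symm (Fin.last m)) i with rfl | ⟨i, rfl⟩
    · rw [Equiv.apply_symm_apply, h1, Equiv.apply_symm_apply]
    · rw [hρ, h1, hρ, h2]
  -- Since `D` is injective, every `σ` can impose its own target on the array of direction `σ.symm
  -- (Fin.last m)`; the default `0` is never read at a point `D σ`.
  choose L hL using fun p => ih fun ρ => Function.extend D s (fun _ => 0) (p, ρ)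
  obtain ⟨b, hb, hbL⟩ := exists_rearrangement_line_sums hm ha L
  refine ⟨b, hb, fun σ k hk => ?_⟩
  have h := hL (σ.symm (Fin.last m)) (ρ σ) k hk
  rw [show (σ.symm (Fin.last m), ρ σ) = D σ from rfl, hD.extend_apply] at h
  refine hasPartialIteratedSum_succ_of_innermost hm (fun w => ?_) h
  refine (hbL (σ.symm (Fin.last m)) fun i => w (ρ σ i)).congr fun N =>
    Finset.sum_congr rfl fun t _ => congrArg b ?_
  rw [Fin.insertNth_eq_iff]
  refine ⟨by simp, ?_⟩
  ext i
  simp only [Fin.removeNth, hρ, Fin.snoc_castSucc]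

theorem exists_hasPartialIteratedSum {m : ℕ} (hm : 1 ≤ m) {a : ℕ → ℝ} (ha : CondConvergent a)
    (s : Equiv.Perm (Fin m) → ℕ → ℝ) : ∃ b : (Fin m → ℕ) → ℝ,
      ∀ (σ : Equiv.Perm (Fin m)) (k : ℕ), 1 ≤ k →
        HasPartialIteratedSum k m (fun j => b (fun i => j (σ i))) (s σ k) := by
  induction m, hm using Nat.le_induction with
  | base =>
    -- Differences telescope to `s 1 k`; the value at `0` is replaced by `0` because an empty sum
    -- vanishes and only `k ≥ 1` is prescribed.
    refine ⟨fun v => s 1 (v 0 + 1) - if v 0 = 0 then 0 else s 1 (v 0), fun σ k hk => ?_⟩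
    obtain rfl : σ = 1 := Subsingleton.elim _ _
    refine ⟨fun j => s 1 (j + 1) - if j = 0 then 0 else s 1 j, fun j _ => rfl, ?_⟩
    have := Finset.sum_range_sub (fun j => if j = 0 then 0 else s 1 j) k
    simpa [Nat.one_le_iff_ne_zero.1 hk] using this
  | succ m hm ih =>
    obtain ⟨b, -, hb⟩ := exists_rearrangement_succ hm ha ih s
    exact ⟨b, hb⟩

theorem theorem1 (n : ℕ) (hn : 2 ≤ n) (a : ℕ → ℝ) (ha : CondConvergent a)
    (s : Equiv.Perm (Fin n) → ℕ → ℝ) :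
    ∃ b : (Fin n → ℕ) → ℝ, IsRearrangement a b ∧
      ∀ (σ : Equiv.Perm (Fin n)) (k : ℕ), 1 ≤ k →
        HasPartialIteratedSum k n (fun j => b (fun i => j (σ i))) (s σ k) := by
  obtain ⟨m, rfl⟩ := Nat.exists_eq_add_of_le' (show 1 ≤ n by omega)
  exact exists_rearrangement_succ (by omega) ha
    (exists_hasPartialIteratedSum (by omega) ha) s
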